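/- Let $\mathbb T=\mathbb R/\mathbb Z$ be the unit torus with normalized Lebesgue measure $dk$, let $\gamma_0,\gamma_1>0$, and let $(\alpha_x)_{x\in\mathbb Z}$ be real numbers such that - there is $C>0$ with $|\alpha_x|\le Ce^{-|x|/C}$ for all $x\in\mathbb Z$; - the Fourier series $\hat\alpha(k)=\sum_{x\in\mathbb Z}\alpha_xe^{-2\pi ixk}$ is real valued, $\hat\alpha(k)>0$ for $k\ne0$, and $\hat\alpha''(0)>0$ in case $\hat\alpha(0)=0$; - the dispersion relation $\omega(k):=\sqrt{\hat\alpha(k)}$ is strictly increasing on $[0,1/2]$. Put $R(k)=\sin^2(2\pi k)+2\sin^2(\pi k)$, $\mathfrak f=(1,-1)^T$ and, for $\epsilon>0$, $$ \Omega_\epsilon(k)=\begin{pmatrix}-\gamma_0\epsilon R(k)-i\omega(k)&\gamma_0\epsilon R(k)\\ \gamma_0\epsilon R(k)&-\gamma_0\epsilon R(k)+i\omega(k)\end{pmatrix}, $$ $$ J(t)=\int_{\mathbb T}\cos(\omega(k)t)\,dk,\qquad J_\epsilon(t)=\frac12\int_{\mathbb T}\big(e^{\Omega_\epsilon(k)t}\,\mathfrak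 f\big)\cdot\mathfrak f\,dk . $$ Denote by $\tilde f(\lambda)=\int_0^\infty e^{-\lambda t}f(t)\,dt$ the Laplace transform and, for $\lambda\in\mathbb C_+=\{\lambda:\operatorname{Re}\lambda>0\}$, set $\tilde g(\lambda)=(1+\gamma_1\tilde J(\lambda))^{-1}$ and $\tilde g_\epsilon(\lambda)=(1+\gamma_1\tilde J_\epsilon(\lambda))^{-1}$. Define $\tilde r_\epsilon$ by $$ \tilde g_\epsilon(\lambda)=\tilde g(\lambda)+\epsilon\,\tilde r_\epsilon(\lambda),\qquad \lambda\in\mathbb C_+ . $$ Suppose that $K:\mathbb T\to(0,\infty)$ is a uniformly continuous and bounded function with $\inf_{k\in\mathbb T}K(k)>0$. Then, for every $p\in[1,\infty)$, the function $k\mapsto|\tilde r_\epsilon(\epsilon K(k)-i\omega(k))|^p$ is integrable on $\mathbb T$ for each $\epsilon>0$, and $$ \lim_{\epsilon\to0+}\epsilon^p\int_{\mathbb T}\big|\tilde r_\epsilon(\epsilon K(k)-i\omega(k))\big|^p\,dk=0 . $$ -/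

import Mathlib

open MeasureTheory Filter Topology

noncomputable section

namespace HarmonicChain

/-- The unit torus `ℝ / ℤ`; its `volume` is the Haar measure of total mass one. -/
abbrev Torus : Type := UnitAddCircle

/-- The Fourier series `∑ x, α_x exp(-2πi x k)` of a real sequence. -/
def fourierSeries (α : ℤ → ℝ) (k : Torus) : ℂ :=
  ∑' x : ℤ, (α x : ℂ) * fourier (-x) k

/-- The dispersion relation `ω = √α̂`. -/
def dispersion (α : ℤ → ℝ) (k : Torus) : ℝ :=
  Real.sqrt (fourierSeries α k).re

/-- The standing assumptions on the coupling constants. -/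
structure IsAdmissibleCoupling (α : ℤ → ℝ) : Prop where
  exp_decay : ∃ C : ℝ, 0 < C ∧ ∀ x : ℤ, |α x| ≤ C * Real.exp (-|(x : ℝ)| / C)
  real_valued : ∀ k : Torus, (fourierSeries α k).im = 0
  pos : ∀ k : Torus, k ≠ 0 → 0 < (fourierSeries α k).re
  second_deriv_pos : fourierSeries α 0 = 0 →
    0 < iteratedDeriv 2 (fun s : ℝ => (fourierSeries α (s : Torus)).re) 0
  unimodal : StrictMonoOn (fun s : ℝ => dispersion α (s : Torus)) (Set.Icc 0 (1 / 2))

/-- `sin²(2πs) + 2 sin²(πs)`, as a function of a real variable. -/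
def scatteringReal (s : ℝ) : ℝ :=
  Real.sin (2 * Real.pi * s) ^ 2 + 2 * Real.sin (Real.pi * s) ^ 2

lemma scatteringReal_periodic : Function.Periodic scatteringReal 1 := by
  intro s
  have h1 : 2 * Real.pi * (s + 1) = 2 * Real.pi * s + 2 * Real.pi := by ring
  have h2 : Real.pi * (s + 1) = Real.pi * s + Real.pi := by ring
  simp only [scatteringReal, h1, h2, Real.sin_add_two_pi, Real.sin_add_pi, neg_sq]

/-- The total scattering kernel `R(k) = sin²(2πk) + 2 sin²(πk)` on the torus. -/
def scattering : Torus → ℝ := scatteringReal_periodic.lift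

/-- The kernel `r(k,k') = 4 sin(πk) sin(π(k-k')) sin(π(2k-k'))`, in real variables. -/
def scatteringAmplitude (k k' : ℝ) : ℝ :=
  4 * Real.sin (Real.pi * k) * Real.sin (Real.pi * (k - k')) * Real.sin (Real.pi * (2 * k - k'))

/-- The closed form of `R` agrees with `∫_𝕋 r²(k,k') dk'`. -/
lemma integral_scatteringAmplitude_sq (k : ℝ) :
    ∫ k' in (-(1 / 2) : ℝ)..(1 / 2), scatteringAmplitude k k' ^ 2 = scatteringReal k := by
  have key : ∀ k' : ℝ, HasDerivAt (fun x : ℝ => 4 * Real.sin (Real.pi * k) ^ 2 *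
      (x * (1 + Real.cos (2 * Real.pi * k) / 2)
        + Real.sin (2 * Real.pi * (k - x)) / (2 * Real.pi)
        + Real.sin (2 * Real.pi * (2 * k - x)) / (2 * Real.pi)
        - Real.sin (2 * Real.pi * (3 * k - 2 * x)) / (8 * Real.pi)))
      (scatteringAmplitude k k' ^ 2) k' := by
    intro k'
    have hs : ∀ a b c : ℝ, HasDerivAt (fun x : ℝ => Real.sin (2 * Real.pi * (a - b * x)) / c)
        (Real.cos (2 * Real.pi * (a - b * k')) * (2 * Real.pi * (-b)) / c) k' := by
      intro a b c
      have h0 : HasDerivAt (fun x : ℝ => 2 * Real.pi * (a - b * x)) (2 * Real.pi * (-b)) k' := by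
        simpa using (((hasDerivAt_id k').const_mul b).const_sub a).const_mul (2 * Real.pi)
      exact h0.sin.div_const c
    have h1 := hs k 1 (2 * Real.pi)
    have h2 := hs (2 * k) 1 (2 * Real.pi)
    have h3 := hs (3 * k) 2 (8 * Real.pi)
    simp only [one_mul] at h1 h2
    have h := (((((hasDerivAt_id k').mul_const (1 + Real.cos (2 * Real.pi * k) / 2)).add
      h1).add h2).sub h3).const_mul (4 * Real.sin (Real.pi * k) ^ 2)
    refine h.congr_deriv ?_
    symm
    have e1 : 2 * Real.pi * (k - k') = 2 * (Real.pi * (k - k')) := by ring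
    have e2 : 2 * Real.pi * (2 * k - k') = 2 * (Real.pi * (2 * k - k')) := by ring
    have e3 : 2 * Real.pi * (3 * k - 2 * k')
        = 2 * (Real.pi * (k - k')) + 2 * (Real.pi * (2 * k - k')) := by ring
    have e4 : 2 * Real.pi * k = 2 * (Real.pi * (2 * k - k')) - 2 * (Real.pi * (k - k')) := by ring
    have hpi := Real.pi_ne_zero
    rw [e3, e4, e1, e2, Real.cos_add, Real.cos_sub, scatteringAmplitude]
    generalize Real.pi * (k - k') = A
    generalize Real.pi * (2 * k - k') = B
    have hA : Real.sin A ^ 2 = 1 / 2 - Real.cos (2 * A) / 2 := Real.sin_sq_eq_half_sub A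
    have hB : Real.sin B ^ 2 = 1 / 2 - Real.cos (2 * B) / 2 := Real.sin_sq_eq_half_sub B
    rw [mul_pow, mul_pow, mul_pow, hA, hB]
    field_simp
    ring
  rw [intervalIntegral.integral_eq_sub_of_hasDerivAt (fun x _ => key x)
    (Continuous.intervalIntegrable (by unfold scatteringAmplitude; fun_prop) _ _)]
  have f1 : 2 * Real.pi * (k - 1 / 2) = 2 * Real.pi * k - Real.pi := by ring
  have f2 : 2 * Real.pi * (k - -(1 / 2)) = 2 * Real.pi * k + Real.pi := by ring
  have f3 : 2 * Real.pi * (2 * k - 1 / 2) = 2 * Real.pi * (2 * k) - Real.pi := by ring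
  have f4 : 2 * Real.pi * (2 * k - -(1 / 2)) = 2 * Real.pi * (2 * k) + Real.pi := by ring
  have f5 : 2 * Real.pi * (3 * k - 2 * (1 / 2)) = 2 * Real.pi * (3 * k) - 2 * Real.pi := by ring
  have f6 : 2 * Real.pi * (3 * k - 2 * -(1 / 2)) = 2 * Real.pi * (3 * k) + 2 * Real.pi := by ring
  have f7 : 2 * Real.pi * k = 2 * (Real.pi * k) := by ring
  simp only [f1, f2, f3, f4, f5, f6, Real.sin_sub_pi, Real.sin_add_pi, Real.sin_sub_two_pi,
    Real.sin_add_two_pi, scatteringReal]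
  rw [f7, Real.sin_two_mul, Real.cos_two_mul, mul_pow, mul_pow, Real.sin_sq]
  ring

/-- The matrix
`Ω_ε(k) = [[-γ₀ε R(k) - iω(k), γ₀ε R(k)], [γ₀ε R(k), -γ₀ε R(k) + iω(k)]]`. -/
def Omega (γ₀ : ℝ) (α : ℤ → ℝ) (ε : ℝ) (k : Torus) : Matrix (Fin 2) (Fin 2) ℂ :=
  !![-((γ₀ * ε * scattering k : ℝ) : ℂ) - Complex.I * (dispersion α k : ℂ),
      ((γ₀ * ε * scattering k : ℝ) : ℂ);
     ((γ₀ * ε * scattering k : ℝ) : ℂ),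
      -((γ₀ * ε * scattering k : ℝ) : ℂ) + Complex.I * (dispersion α k : ℂ)]

/-- The vector `𝔣 = (1, -1)`. -/
def fVec : Fin 2 → ℂ := ![1, -1]

/-- `j_ε(t,k) = ½ exp(Ω_ε(k) t) 𝔣 · 𝔣`. -/
def jEps (γ₀ : ℝ) (α : ℤ → ℝ) (ε t : ℝ) (k : Torus) : ℂ :=
  (1 / 2 : ℂ) * dotProduct (Matrix.mulVec (NormedSpace.exp ((t : ℂ) • Omega γ₀ α ε k)) fVec) fVec

/-- `J_ε(t) = ∫_𝕋 j_ε(t,k) dk`. -/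
def JEps (γ₀ : ℝ) (α : ℤ → ℝ) (ε t : ℝ) : ℂ := ∫ k : Torus, jEps γ₀ α ε t k

/-- `J(t) = ∫_𝕋 cos(ω(k) t) dk`. -/
def J (α : ℤ → ℝ) (t : ℝ) : ℝ := ∫ k : Torus, Real.cos (dispersion α k * t)

/-- The Laplace transform `∫_0^∞ exp(-z t) f(t) dt`. -/
def laplace (f : ℝ → ℂ) (z : ℂ) : ℂ :=
  ∫ t in Set.Ioi (0 : ℝ), Complex.exp (-z * (t : ℂ)) * f t

/-- `g̃(z) = (1 + γ₁ J̃(z))⁻¹`. -/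
def gTilde (γ₁ : ℝ) (α : ℤ → ℝ) (z : ℂ) : ℂ :=
  (1 + (γ₁ : ℂ) * laplace (fun t => (J α t : ℂ)) z)⁻¹

/-- `g̃_ε(z) = (1 + γ₁ J̃_ε(z))⁻¹`. -/
def gTildeEps (γ₀ γ₁ : ℝ) (α : ℤ → ℝ) (ε : ℝ) (z : ℂ) : ℂ :=
  (1 + (γ₁ : ℂ) * laplace (JEps γ₀ α ε) z)⁻¹

/-- The remainder `r̃_ε = (g̃_ε - g̃) / ε`. -/
def rTilde (γ₀ γ₁ : ℝ) (α : ℤ → ℝ) (ε : ℝ) (z : ℂ) : ℂ :=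
  (gTildeEps γ₀ γ₁ α ε z - gTilde γ₁ α z) / (ε : ℂ)

end HarmonicChain

end

/- `JEps` is an average over the torus of velocities of damped harmonic oscillators, so its Laplace
transform is an average of resolvents `z / (z² + 2 a z + ω²)`. These have nonnegative real part,
hence `g̃_ε` is bounded by `1` and `g̃_ε - g̃` by `γ₁` times the difference of the averages. On the
ray `z = ε κ - i ω(s)` the integrand of this difference concentrates at the points `± s`. If `s` is
a regular point of `ω²`, the blow-up `x = s + ε y` turns it into an integrand whose limit has both
poles in the same half plane and therefore integrates to zero. Almost every point is regular because
`ω²` is real analytic, so dominated convergence applies. -/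

namespace HarmonicChain

open Complex (I)

section Laplace

variable {f f₁ f₂ f' : ℝ → ℂ} {z : ℂ}

lemma integrableOn_exp_neg_mul (hz : 0 < z.re) :
    IntegrableOn (fun t : ℝ => Complex.exp (-z * t)) (Set.Ioi 0) := by
  simpa only [Complex.ofReal_zero] using!
    integrableOn_exp_mul_complex_Ioi (a := -z) (by simpa using hz) 0

lemma integrableOn_exp_neg_mul_mul {C : ℝ} (hz : 0 < z.re)
    (hf : AEStronglyMeasurable f (volume.restrict (Set.Ioi 0))) (hC : ∀ t, 0 ≤ t → ‖f t‖ ≤ C) :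
    IntegrableOn (fun t : ℝ => Complex.exp (-z * t) * f t) (Set.Ioi 0) :=
  (integrableOn_exp_neg_mul hz).mul_bdd hf
    ((ae_restrict_mem measurableSet_Ioi).mono fun t ht => hC t (le_of_lt ht))

lemma laplace_const_mul_add_const_mul (c₁ c₂ : ℂ)
    (hf₁ : IntegrableOn (fun t : ℝ => Complex.exp (-z * t) * f₁ t) (Set.Ioi 0))
    (hf₂ : IntegrableOn (fun t : ℝ => Complex.exp (-z * t) * f₂ t) (Set.Ioi 0)) :
    laplace (fun t => c₁ * f₁ t + c₂ * f₂ t) z = c₁ * laplace f₁ z + c₂ * laplace f₂ z := by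
  simp only [laplace, mul_add, mul_left_comm _ c₁, mul_left_comm _ c₂]
  rw [integral_add (hf₁.const_mul c₁) (hf₂.const_mul c₂), integral_const_mul, integral_const_mul]

lemma tendsto_exp_neg_mul_mul_atTop {C : ℝ} (hz : 0 < z.re) (hC : ∀ t, 0 ≤ t → ‖f t‖ ≤ C) :
    Tendsto (fun t : ℝ => Complex.exp (-z * t) * f t) atTop (𝓝 0) := by
  have hexp : Tendsto (fun t : ℝ => Real.exp (-z.re * t) * C) atTop (𝓝 0) := by
    simpa only [Function.comp_def, id_eq, zero_mul] using (Real.tendsto_exp_atBot.comp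
      (tendsto_id.const_mul_atTop_of_neg (neg_neg_of_pos hz))).mul_const C
  refine squeeze_zero_norm' ?_ hexp
  filter_upwards [eventually_ge_atTop 0] with t ht
  have hre : (-z * (t : ℂ)).re = -z.re * t := by
    rw [Complex.re_mul_ofReal, Complex.neg_re]
  rw [norm_mul, Complex.norm_exp, hre]
  exact mul_le_mul_of_nonneg_left (hC t ht) (Real.exp_pos _).le

lemma laplace_deriv {C : ℝ} (hz : 0 < z.re) (hf : ∀ t, HasDerivAt f (f' t) t)
    (hC : ∀ t, 0 ≤ t → ‖f t‖ ≤ C)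
    (hf' : IntegrableOn (fun t : ℝ => Complex.exp (-z * t) * f' t) (Set.Ioi 0)) :
    laplace f' z = z * laplace f z - f 0 := by
  have hderiv (t : ℝ) : HasDerivAt (fun t : ℝ => Complex.exp (-z * t) * f t)
      (-z * (Complex.exp (-z * t) * f t) + Complex.exp (-z * t) * f' t) t := by
    have hexp : HasDerivAt (fun t : ℝ => Complex.exp (-z * t)) (Complex.exp (-z * t) * -z) t := by
      simpa only [id_eq, mul_one] using! ((hasDerivAt_id (t : ℂ)).const_mul (-z)).cexp.comp_ofReal
    exact (hexp.mul (hf t)).congr_deriv (by ring)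
  have hcont : Continuous f := continuous_iff_continuousAt.2 fun t => (hf t).continuousAt
  have hint := (integrableOn_exp_neg_mul_mul hz hcont.aestronglyMeasurable hC).const_mul (-z)
  have hparts := integral_Ioi_of_hasDerivAt_of_tendsto (hderiv 0).continuousAt.continuousWithinAt
    (fun t _ => hderiv t) (hint.add hf') (tendsto_exp_neg_mul_mul_atTop hz hC)
  rw [integral_add hint hf', integral_const_mul, Complex.ofReal_zero, mul_zero, Complex.exp_zero,
    one_mul, zero_sub] at hparts
  change laplace f' z = z * (∫ t in Set.Ioi (0 : ℝ), Complex.exp (-z * t) * f t) - f 0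
  rw [laplace]
  linear_combination hparts

lemma laplace_integral {X : Type*} [MeasurableSpace X] {μ : Measure X} [IsFiniteMeasure μ]
    {F : ℝ → X → ℂ} {C : ℝ} (hz : 0 < z.re)
    (hF : AEStronglyMeasurable (Function.uncurry F) ((volume.restrict (Set.Ioi 0)).prod μ))
    (hC : ∀ t x, 0 ≤ t → ‖F t x‖ ≤ C) :
    laplace (fun t => ∫ x, F t x ∂μ) z = ∫ x, laplace (fun t => F t x) z ∂μ := by
  simp only [laplace, ← integral_const_mul]
  apply integral_integral_swap
  have hexp : Integrable (fun q : ℝ × X => Complex.exp (-z * (q.1 : ℂ)))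
      ((volume.restrict (Set.Ioi 0)).prod μ) := by
    simpa only [mul_one] using
      (integrableOn_exp_neg_mul hz).mul_prod (integrable_const (1 : ℂ) (μ := μ))
  have hpos : ∀ᵐ q ∂((volume.restrict (Set.Ioi (0 : ℝ))).prod μ), 0 < q.1 :=
    Measure.quasiMeasurePreserving_fst.ae (ae_restrict_mem measurableSet_Ioi)
  exact hexp.mul_bdd hF (hpos.mono fun q hq => hC _ _ hq.le)

lemma measurable_laplace (hf : StronglyMeasurable f) : Measurable (laplace f) := by
  refine (StronglyMeasurable.integral_prod_right
    (f := fun (z : ℂ) (t : ℝ) => Complex.exp (-z * t) * f t) ?_).measurable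
  have hexp : Continuous fun q : ℂ × ℝ => Complex.exp (-q.1 * q.2) := by fun_prop
  exact hexp.stronglyMeasurable.mul (hf.comp_measurable measurable_snd)

end Laplace

section Resolvent

/-- The characteristic polynomial `z² + 2 a z + φ` of the oscillator `ẍ + 2 a ẋ + φ x = 0` with
damping `a` and squared frequency `φ`. -/
def charDenom (a φ : ℝ) (z : ℂ) : ℂ := z ^ 2 + 2 * a * z + φ

/-- The Laplace transform `z / (z² + 2 a z + φ)` of the velocity of a damped oscillator started
from its equilibrium with unit velocity. -/
noncomputable def resolvent (a φ : ℝ) (z : ℂ) : ℂ := z / charDenom a φ z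

variable {a φ : ℝ} {z : ℂ}

lemma charDenom_eq_mul (hz : z ≠ 0) : charDenom a φ z = z * (z + 2 * a + φ / z) := by
  rw [charDenom]
  field_simp

lemma re_le_re_add_div (ha : 0 ≤ a) (hφ : 0 ≤ φ) (hz : 0 < z.re) :
    z.re ≤ (z + 2 * a + φ / z).re := by
  have hdiv : 0 ≤ ((φ : ℂ) / z).re := by
    rw [div_eq_mul_inv, Complex.re_ofReal_mul, Complex.inv_re]
    exact mul_nonneg hφ (div_nonneg hz.le (Complex.normSq_nonneg z))
  have hdamp : (2 * (a : ℂ)).re = 2 * a := by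
    exact_mod_cast Complex.ofReal_re (2 * a)
  rw [Complex.add_re, Complex.add_re, hdamp]
  linarith

lemma charDenom_ne_zero (ha : 0 ≤ a) (hφ : 0 ≤ φ) (hz : 0 < z.re) : charDenom a φ z ≠ 0 := by
  rw [charDenom_eq_mul (Complex.ne_zero_of_re_pos hz)]
  exact mul_ne_zero (Complex.ne_zero_of_re_pos hz)
    (Complex.ne_zero_of_re_pos (hz.trans_le (re_le_re_add_div ha hφ hz)))

lemma resolvent_eq_inv (hz : z ≠ 0) : resolvent a φ z = (z + 2 * a + φ / z)⁻¹ := by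
  rw [resolvent, charDenom_eq_mul hz, div_mul_eq_div_div, div_self hz, one_div]

lemma re_resolvent_nonneg (ha : 0 ≤ a) (hφ : 0 ≤ φ) (hz : 0 < z.re) :
    0 ≤ (resolvent a φ z).re := by
  rw [resolvent_eq_inv (Complex.ne_zero_of_re_pos hz), Complex.inv_re]
  exact div_nonneg (hz.le.trans (re_le_re_add_div ha hφ hz)) (Complex.normSq_nonneg _)

lemma norm_resolvent_le (ha : 0 ≤ a) (hφ : 0 ≤ φ) (hz : 0 < z.re) :
    ‖resolvent a φ z‖ ≤ z.re⁻¹ := by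
  rw [resolvent_eq_inv (Complex.ne_zero_of_re_pos hz), norm_inv]
  exact inv_anti₀ hz ((re_le_re_add_div ha hφ hz).trans (Complex.re_le_norm _))

variable {X : Type*} [MeasurableSpace X] {μ : Measure X} {b ω : X → ℝ}

lemma integrable_resolvent [IsFiniteMeasure μ] (hb : Measurable b) (hω : Measurable ω)
    (hb₀ : ∀ x, 0 ≤ b x) (hz : 0 < z.re) :
    Integrable (fun x => resolvent (b x) (ω x ^ 2) z) μ := by
  have hmeas : Measurable fun x => resolvent (b x) (ω x ^ 2) z := by
    unfold resolvent charDenom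
    fun_prop
  exact Integrable.of_bound hmeas.aestronglyMeasurable z.re⁻¹
    (Eventually.of_forall fun x => norm_resolvent_le (hb₀ x) (sq_nonneg _) hz)

/-- The average over `μ` of the resolvents of oscillators with damping `b` and frequency `ω`. -/
noncomputable def averagedResolvent (μ : Measure X) (b ω : X → ℝ) (z : ℂ) : ℂ :=
  ∫ x, resolvent (b x) (ω x ^ 2) z ∂μ

lemma re_averagedResolvent_nonneg [IsFiniteMeasure μ] (hb : Measurable b) (hω : Measurable ω)
    (hb₀ : ∀ x, 0 ≤ b x) (hz : 0 < z.re) : 0 ≤ (averagedResolvent μ b ω z).re := by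
  have hre := integral_re (integrable_resolvent (μ := μ) hb hω hb₀ hz)
  simp only [RCLike.re_to_complex] at hre
  rw [averagedResolvent, ← hre]
  exact integral_nonneg fun x => re_resolvent_nonneg (hb₀ x) (sq_nonneg _) hz

lemma averagedResolvent_sub [IsFiniteMeasure μ] {b₁ b₂ : X → ℝ} (hb₁ : Measurable b₁)
    (hb₂ : Measurable b₂) (hω : Measurable ω) (hb₁₀ : ∀ x, 0 ≤ b₁ x) (hb₂₀ : ∀ x, 0 ≤ b₂ x)
    (hz : 0 < z.re) :
    averagedResolvent μ b₁ ω z - averagedResolvent μ b₂ ω z =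
      ∫ x, (resolvent (b₁ x) (ω x ^ 2) z - resolvent (b₂ x) (ω x ^ 2) z) ∂μ :=
  (integral_sub (integrable_resolvent hb₁ hω hb₁₀ hz)
    (integrable_resolvent hb₂ hω hb₂₀ hz)).symm

end Resolvent

section DampedOscillator

/-- The velocity `w` and rescaled position `v = -iωx` of a damped harmonic oscillator
`ẍ + 2 a ẋ + ω² x = 0` released from `x = 0` with unit velocity. -/
structure IsDampedOscillator (a ω : ℝ) (w v : ℝ → ℂ) : Prop where
  hasDerivAt_velocity : ∀ t, HasDerivAt w (-2 * a * w t + -I * ω * v t) t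
  hasDerivAt_position : ∀ t, HasDerivAt v (-I * ω * w t) t
  velocity_zero : w 0 = 1
  position_zero : v 0 = 0

namespace IsDampedOscillator

variable {a ω : ℝ} {w v : ℝ → ℂ}

/- Energy dissipation: `‖w‖² + ‖v‖²` has derivative `-4 a ‖w‖²`. -/
lemma norm_sq_add_norm_sq_le_one (h : IsDampedOscillator a ω w v) (ha : 0 ≤ a) {t : ℝ}
    (ht : 0 ≤ t) : ‖w t‖ ^ 2 + ‖v t‖ ^ 2 ≤ 1 := by
  have hderiv (s : ℝ) :
      HasDerivAt (fun s => ‖w s‖ ^ 2 + ‖v s‖ ^ 2) (-4 * a * ‖w s‖ ^ 2) s := by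
    refine ((h.hasDerivAt_velocity s).norm_sq.add (h.hasDerivAt_position s).norm_sq).congr_deriv ?_
    rw [Complex.inner, Complex.inner, ← Complex.normSq_eq_norm_sq, Complex.normSq_apply]
    simp
    ring
  have hanti := antitone_of_hasDerivAt_nonpos hderiv fun s =>
    mul_nonpos_of_nonpos_of_nonneg (by linarith) (sq_nonneg _)
  simpa [h.velocity_zero, h.position_zero] using hanti ht

lemma norm_velocity_le_one (h : IsDampedOscillator a ω w v) (ha : 0 ≤ a) (t : ℝ) (ht : 0 ≤ t) :
    ‖w t‖ ≤ 1 :=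
  (sq_le_one_iff₀ (norm_nonneg _)).1
    (le_of_add_le_of_nonneg_left (h.norm_sq_add_norm_sq_le_one ha ht) (sq_nonneg _))

lemma norm_position_le_one (h : IsDampedOscillator a ω w v) (ha : 0 ≤ a) (t : ℝ) (ht : 0 ≤ t) :
    ‖v t‖ ≤ 1 :=
  (sq_le_one_iff₀ (norm_nonneg _)).1
    (le_of_add_le_of_nonneg_right (h.norm_sq_add_norm_sq_le_one ha ht) (sq_nonneg _))

lemma laplace_velocity (h : IsDampedOscillator a ω w v) (ha : 0 ≤ a) {z : ℂ} (hz : 0 < z.re) :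
    laplace w z = resolvent a (ω ^ 2) z := by
  have hwc : Continuous w :=
    continuous_iff_continuousAt.2 fun t => (h.hasDerivAt_velocity t).continuousAt
  have hvc : Continuous v :=
    continuous_iff_continuousAt.2 fun t => (h.hasDerivAt_position t).continuousAt
  have hw := integrableOn_exp_neg_mul_mul hz hwc.aestronglyMeasurable (h.norm_velocity_le_one ha)
  have hv := integrableOn_exp_neg_mul_mul hz hvc.aestronglyMeasurable (h.norm_position_le_one ha)
  have hw' := laplace_deriv hz h.hasDerivAt_velocity (h.norm_velocity_le_one ha) (by
    simpa only [mul_add, mul_left_comm] using!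
      (hw.const_mul (-2 * a : ℂ)).add (hv.const_mul (-I * ω)))
  have hv' := laplace_deriv hz h.hasDerivAt_position (h.norm_position_le_one ha) (by
    simpa only [mul_left_comm] using! hw.const_mul (-I * ω))
  rw [laplace_const_mul_add_const_mul _ _ hw hv, h.velocity_zero] at hw'
  have hv'' : laplace (fun t => -I * ω * w t) z = -I * ω * laplace w z := by
    simpa using laplace_const_mul_add_const_mul (-I * ω) 0 hw hw
  rw [hv'', h.position_zero, sub_zero] at hv'
  rw [resolvent, eq_div_iff (charDenom_ne_zero ha (sq_nonneg ω) hz), charDenom]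
  push_cast
  linear_combination (-z) * hw' + I * ω * hv' + ω ^ 2 * laplace w z * Complex.I_sq

end IsDampedOscillator

end DampedOscillator

section MatrixExponential

attribute [local instance] Matrix.linftyOpNormedRing Matrix.linftyOpNormedAlgebra

variable {n : Type*} [Fintype n] [DecidableEq n]

lemma continuous_matrix_exp : Continuous (NormedSpace.exp : Matrix n n ℂ → Matrix n n ℂ) := by
  let _ : NormedAlgebra ℚ (Matrix n n ℂ) := NormedAlgebra.restrictScalars ℚ ℂ _
  exact NormedSpace.exp_continuous

lemma hasDerivAt_matrix_exp_mulVec (A : Matrix n n ℂ) (u : n → ℂ) (t : ℝ) :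
    HasDerivAt (fun s : ℝ => (NormedSpace.exp ((s : ℂ) • A)).mulVec u)
      (A.mulVec ((NormedSpace.exp ((t : ℂ) • A)).mulVec u)) t := by
  have hexp : HasDerivAt (fun s : ℝ => NormedSpace.exp ((s : ℂ) • A))
      (A * NormedSpace.exp ((t : ℂ) • A)) t := by
    simpa only [Complex.ofRealCLM_apply, Complex.ofReal_one, one_smul] using!
      (hasDerivAt_exp_smul_const' A (t : ℂ)).scomp t Complex.ofRealCLM.hasDerivAt
  let applyTo : Matrix n n ℂ →L[ℝ] (n → ℂ) :=
    LinearMap.toContinuousLinearMap ((Matrix.mulVecBilin ℝ ℝ).flip u)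
  rw [Matrix.mulVec_mulVec]
  exact applyTo.hasFDerivAt.comp_hasDerivAt t hexp

end MatrixExponential

section Velocity

variable (γ₀ : ℝ) (α : ℤ → ℝ) (ε t : ℝ) (k : Torus)

lemma jEps_eq : jEps γ₀ α ε t k = (1 / 2 : ℂ) *
    ((NormedSpace.exp ((t : ℂ) • Omega γ₀ α ε k)).mulVec fVec 0
      - (NormedSpace.exp ((t : ℂ) • Omega γ₀ α ε k)).mulVec fVec 1) := by
  simp only [jEps, dotProduct, Fin.sum_univ_two, fVec, Matrix.cons_val_zero, Matrix.cons_val_one]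
  ring

/-- The component of `½ exp(Ω_ε(k) t) 𝔣` along `(1, 1)`, the companion of `jEps` in the first order
system they satisfy. -/
noncomputable def jEpsPosition : ℂ :=
  (1 / 2 : ℂ) * ((NormedSpace.exp ((t : ℂ) • Omega γ₀ α ε k)).mulVec fVec 0
    + (NormedSpace.exp ((t : ℂ) • Omega γ₀ α ε k)).mulVec fVec 1)

lemma isDampedOscillator_jEps :
    IsDampedOscillator (γ₀ * ε * scattering k) (dispersion α k)
      (fun t => jEps γ₀ α ε t k) (fun t => jEpsPosition γ₀ α ε t k) := by
  have hderiv (t : ℝ) :=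
    hasDerivAt_pi.1 (hasDerivAt_matrix_exp_mulVec (Omega γ₀ α ε k) fVec t)
  refine ⟨fun t => ?_, fun t => ?_, ?_, ?_⟩
  · simp only [jEps_eq, jEpsPosition]
    refine (((hderiv t 0).sub (hderiv t 1)).const_mul (1 / 2 : ℂ)).congr_deriv ?_
    generalize (NormedSpace.exp ((t : ℂ) • Omega γ₀ α ε k)).mulVec fVec = u
    simp only [Omega, Matrix.mulVec, dotProduct, Fin.sum_univ_two, Matrix.of_apply,
      Matrix.cons_val_zero, Matrix.cons_val_one]
    ring
  · simp only [jEps_eq, jEpsPosition]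
    refine (((hderiv t 0).add (hderiv t 1)).const_mul (1 / 2 : ℂ)).congr_deriv ?_
    generalize (NormedSpace.exp ((t : ℂ) • Omega γ₀ α ε k)).mulVec fVec = u
    simp only [Omega, Matrix.mulVec, dotProduct, Fin.sum_univ_two, Matrix.of_apply,
      Matrix.cons_val_zero, Matrix.cons_val_one]
    ring
  · norm_num [jEps_eq, fVec, NormedSpace.exp_zero]
  · norm_num [jEpsPosition, fVec, NormedSpace.exp_zero]

lemma jEps_zero : jEps γ₀ α 0 t k = Real.cos (dispersion α k * t) := by
  have hdiag : (t : ℂ) • Omega γ₀ α 0 k = Matrix.diagonal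
      ![-(dispersion α k * t : ℝ) * I, (dispersion α k * t : ℝ) * I] := by
    ext i j
    fin_cases i <;> fin_cases j <;> simp [Omega] <;> ring
  rw [jEps, hdiag, Matrix.exp_diagonal, Complex.ofReal_cos, Complex.cos]
  simp [dotProduct, Matrix.mulVec_diagonal, Fin.sum_univ_two, fVec, Pi.coe_exp,
    ← Complex.exp_eq_exp_ℂ]
  ring

lemma JEps_zero (t : ℝ) : JEps γ₀ α 0 t = J α t := by
  simp only [JEps, jEps_zero, J, integral_complex_ofReal]

lemma gTildeEps_zero (γ₁ : ℝ) (z : ℂ) : gTildeEps γ₀ γ₁ α 0 z = gTilde γ₁ α z := by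
  rw [gTildeEps, gTilde, funext (JEps_zero γ₀ α)]

end Velocity

section Scattering

lemma continuous_scattering : Continuous scattering :=
  continuous_coinduced_dom.2 (by
    change Continuous scatteringReal
    unfold scatteringReal
    fun_prop)

lemma scattering_coe (s : ℝ) : scattering (s : Torus) = scatteringReal s := rfl

lemma scattering_nonneg (k : Torus) : 0 ≤ scattering k := by
  induction k using QuotientAddGroup.induction_on with
  | H s =>
    rw [scattering_coe, scatteringReal]
    positivity

lemma scattering_neg (k : Torus) : scattering (-k) = scattering k := by
  induction k using QuotientAddGroup.induction_on with
  | H s =>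
    rw [← AddCircle.coe_neg, scattering_coe, scattering_coe]
    simp only [scatteringReal, mul_neg, Real.sin_neg, neg_sq]

end Scattering

section MemoryKernel

variable {α : ℤ → ℝ} {γ₀ γ₁ ε : ℝ} {z : ℂ}

lemma continuous_jEps (hω : Continuous (dispersion α)) :
    Continuous (Function.uncurry (jEps γ₀ α ε)) := by
  have hΩ : Continuous (Omega γ₀ α ε) := by
    have := continuous_scattering
    refine continuous_matrix fun i j => ?_
    fin_cases i <;> fin_cases j <;> simp only [Omega, Matrix.of_apply] <;> fun_prop
  have hexp : Continuous fun q : ℝ × Torus => NormedSpace.exp ((q.1 : ℂ) • Omega γ₀ α ε q.2) :=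
    continuous_matrix_exp.comp
      ((Complex.continuous_ofReal.comp continuous_fst).smul (hΩ.comp continuous_snd))
  exact continuous_const.mul ((hexp.matrix_mulVec continuous_const).dotProduct continuous_const)

lemma stronglyMeasurable_JEps (hω : Continuous (dispersion α)) :
    StronglyMeasurable (JEps γ₀ α ε) :=
  (continuous_jEps hω).stronglyMeasurable.integral_prod_right

lemma laplace_JEps (hω : Continuous (dispersion α)) (hγ₀ : 0 ≤ γ₀) (hε : 0 ≤ ε) (hz : 0 < z.re) :
    laplace (JEps γ₀ α ε) z =
      averagedResolvent volume (fun k => γ₀ * ε * scattering k) (dispersion α) z := by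
  have hdamp (k : Torus) : 0 ≤ γ₀ * ε * scattering k :=
    mul_nonneg (mul_nonneg hγ₀ hε) (scattering_nonneg k)
  unfold JEps averagedResolvent
  rw [laplace_integral hz (continuous_jEps hω).aestronglyMeasurable fun t k ht =>
    (isDampedOscillator_jEps γ₀ α ε k).norm_velocity_le_one (hdamp k) t ht]
  exact integral_congr_ae <| Eventually.of_forall fun k =>
    (isDampedOscillator_jEps γ₀ α ε k).laplace_velocity (hdamp k) hz

lemma re_laplace_JEps_nonneg (hω : Continuous (dispersion α)) (hγ₀ : 0 ≤ γ₀) (hε : 0 ≤ ε)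
    (hz : 0 < z.re) : 0 ≤ (laplace (JEps γ₀ α ε) z).re := by
  rw [laplace_JEps hω hγ₀ hε hz]
  exact re_averagedResolvent_nonneg (continuous_scattering.measurable.const_mul _) hω.measurable
    (fun k => mul_nonneg (mul_nonneg hγ₀ hε) (scattering_nonneg k)) hz

lemma one_le_norm_one_add_mul {γ : ℝ} (hγ : 0 ≤ γ) {w : ℂ} (hw : 0 ≤ w.re) :
    1 ≤ ‖1 + (γ : ℂ) * w‖ := by
  have hre : 1 ≤ (1 + (γ : ℂ) * w).re := by
    rw [Complex.add_re, Complex.re_ofReal_mul, Complex.one_re]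
    exact le_add_of_nonneg_right (mul_nonneg hγ hw)
  exact hre.trans (Complex.re_le_norm _)

lemma norm_inv_one_add_mul_sub_le {γ : ℝ} (hγ : 0 ≤ γ) {w v : ℂ} (hw : 0 ≤ w.re)
    (hv : 0 ≤ v.re) :
    ‖(1 + (γ : ℂ) * w)⁻¹ - (1 + (γ : ℂ) * v)⁻¹‖ ≤ γ * ‖w - v‖ := by
  have hw₁ := one_le_norm_one_add_mul hγ hw
  have hv₁ := one_le_norm_one_add_mul hγ hv
  have hdiff : 1 + (γ : ℂ) * v - (1 + (γ : ℂ) * w) = γ * (v - w) := by ring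
  rw [inv_sub_inv (norm_pos_iff.1 (zero_lt_one.trans_le hw₁))
    (norm_pos_iff.1 (zero_lt_one.trans_le hv₁)), norm_div, norm_mul, hdiff, norm_mul,
    Complex.norm_real, Real.norm_of_nonneg hγ, norm_sub_rev]
  exact div_le_self (by positivity) (one_le_mul_of_one_le_of_one_le hw₁ hv₁)

lemma norm_gTildeEps_le_one (hω : Continuous (dispersion α)) (hγ₀ : 0 ≤ γ₀) (hγ₁ : 0 ≤ γ₁)
    (hε : 0 ≤ ε) (hz : 0 < z.re) : ‖gTildeEps γ₀ γ₁ α ε z‖ ≤ 1 := by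
  rw [gTildeEps, norm_inv]
  exact inv_le_one_of_one_le₀
    (one_le_norm_one_add_mul hγ₁ (re_laplace_JEps_nonneg hω hγ₀ hε hz))

lemma norm_gTildeEps_sub_gTilde_le_two (hω : Continuous (dispersion α)) (hγ₀ : 0 ≤ γ₀)
    (hγ₁ : 0 ≤ γ₁) (hε : 0 ≤ ε) (hz : 0 < z.re) :
    ‖gTildeEps γ₀ γ₁ α ε z - gTilde γ₁ α z‖ ≤ 2 := by
  rw [← gTildeEps_zero γ₀ α γ₁ z]
  calc ‖gTildeEps γ₀ γ₁ α ε z - gTildeEps γ₀ γ₁ α 0 z‖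
      ≤ ‖gTildeEps γ₀ γ₁ α ε z‖ + ‖gTildeEps γ₀ γ₁ α 0 z‖ := norm_sub_le _ _
    _ ≤ 1 + 1 := add_le_add (norm_gTildeEps_le_one hω hγ₀ hγ₁ hε hz)
        (norm_gTildeEps_le_one hω hγ₀ hγ₁ le_rfl hz)
    _ = 2 := one_add_one_eq_two

lemma norm_gTildeEps_sub_gTilde_le (hω : Continuous (dispersion α)) (hγ₀ : 0 ≤ γ₀)
    (hγ₁ : 0 ≤ γ₁) (hε : 0 ≤ ε) (hz : 0 < z.re) :
    ‖gTildeEps γ₀ γ₁ α ε z - gTilde γ₁ α z‖ ≤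
      γ₁ * ‖averagedResolvent volume (fun k => γ₀ * ε * scattering k) (dispersion α) z -
        averagedResolvent volume (fun _ => 0) (dispersion α) z‖ := by
  have hzero := laplace_JEps hω hγ₀ le_rfl hz
  simp only [mul_zero, zero_mul] at hzero
  rw [← gTildeEps_zero γ₀ α γ₁ z, ← hzero, ← laplace_JEps hω hγ₀ hε hz]
  exact norm_inv_one_add_mul_sub_le hγ₁ (re_laplace_JEps_nonneg hω hγ₀ hε hz)
    (re_laplace_JEps_nonneg hω hγ₀ le_rfl hz)

lemma measurable_gTildeEps (hω : Continuous (dispersion α)) :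
    Measurable (gTildeEps γ₀ γ₁ α ε) :=
  (((measurable_laplace (stronglyMeasurable_JEps hω)).const_mul _).const_add _).inv

lemma measurable_gTilde (hω : Continuous (dispersion α)) : Measurable (gTilde γ₁ α) := by
  rw [← funext (gTildeEps_zero 0 α γ₁)]
  exact measurable_gTildeEps hω

lemma gTildeEps_eq_gTilde_add (hε : ε ≠ 0) :
    gTildeEps γ₀ γ₁ α ε z = gTilde γ₁ α z + ε * rTilde γ₀ γ₁ α ε z := by
  rw [rTilde, mul_div_cancel₀ _ (Complex.ofReal_ne_zero.2 hε), add_sub_cancel]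

end MemoryKernel

section Symbol

/-- The squared dispersion relation, as a function of a real variable. -/
noncomputable def symbol (α : ℤ → ℝ) (s : ℝ) : ℝ := (fourierSeries α (s : Torus)).re

/-- The analytic continuation of the Fourier series `∑ x, α_x exp(-2πi x k)` to a strip of complex
wave numbers `w`. -/
noncomputable def complexFourierSeries (α : ℤ → ℝ) (w : ℂ) : ℂ :=
  ∑' x : ℤ, (α x : ℂ) * Complex.exp (-2 * Real.pi * I * x * w)

lemma complexFourierSeries_ofReal (α : ℤ → ℝ) (s : ℝ) :
    complexFourierSeries α s = fourierSeries α (s : Torus) := by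
  refine tsum_congr fun x => ?_
  rw [fourier_coe_apply]
  push_cast
  ring_nf

lemma symbol_neg (α : ℤ → ℝ) (s : ℝ) : symbol α (-s) = symbol α s := by
  have hconj : fourierSeries α ((-s : ℝ) : Torus) =
      (starRingEnd ℂ) (fourierSeries α (s : Torus)) := by
    rw [fourierSeries, fourierSeries, Complex.conj_tsum]
    refine tsum_congr fun x => ?_
    rw [map_mul, Complex.conj_ofReal, ← fourier_neg, fourier_coe_apply, fourier_coe_apply]
    push_cast
    ring_nf
  rw [symbol, hconj, Complex.conj_re, symbol]

lemma dispersion_neg (α : ℤ → ℝ) (k : Torus) : dispersion α (-k) = dispersion α k := by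
  induction k using QuotientAddGroup.induction_on with
  | H s => exact congrArg Real.sqrt (symbol_neg α s)

lemma summable_exp_neg_mul_abs_int {c : ℝ} (hc : 0 < c) :
    Summable fun x : ℤ => Real.exp (-c * |(x : ℝ)|) := by
  have hnat : Summable fun n : ℕ => Real.exp (-c * |((n : ℤ) : ℝ)|) :=
    (Real.summable_exp_nat_mul_iff.2 (neg_neg_of_pos hc)).congr fun n => by
      rw [Int.cast_natCast, Nat.abs_cast, mul_comm]
  refine Summable.of_nat_of_neg hnat (hnat.congr fun n => ?_)
  rw [Int.cast_neg, abs_neg]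

variable {α : ℤ → ℝ} {C c : ℝ}

lemma norm_complexFourierSeries_term_le (hα : ∀ x : ℤ, |α x| ≤ C * Real.exp (-c * |(x : ℝ)|))
    {w : ℂ} (hw : 2 * Real.pi * |w.im| ≤ c / 2) (x : ℤ) :
    ‖(α x : ℂ) * Complex.exp (-2 * Real.pi * I * x * w)‖ ≤
      C * Real.exp (-(c / 2) * |(x : ℝ)|) := by
  have hre : (-2 * Real.pi * I * x * w).re = 2 * Real.pi * (x * w.im) := by
    simp
    ring
  have hle : 2 * Real.pi * (x * w.im) ≤ c / 2 * |(x : ℝ)| := by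
    calc 2 * Real.pi * (x * w.im) ≤ 2 * Real.pi * (|(x : ℝ)| * |w.im|) := by
          rw [← abs_mul]
          exact mul_le_mul_of_nonneg_left (le_abs_self _) (by positivity)
      _ = 2 * Real.pi * |w.im| * |(x : ℝ)| := by ring
      _ ≤ c / 2 * |(x : ℝ)| := mul_le_mul_of_nonneg_right hw (abs_nonneg _)
  rw [norm_mul, Complex.norm_real, Complex.norm_exp, hre, Real.norm_eq_abs]
  calc |α x| * Real.exp (2 * Real.pi * (x * w.im))
      ≤ C * Real.exp (-c * |(x : ℝ)|) * Real.exp (c / 2 * |(x : ℝ)|) := by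
        exact mul_le_mul (hα x) (Real.exp_le_exp.2 hle) (Real.exp_pos _).le
          ((abs_nonneg _).trans (hα x))
    _ = C * Real.exp (-(c / 2) * |(x : ℝ)|) := by
        rw [mul_assoc, ← Real.exp_add]
        ring_nf

lemma analyticOnNhd_symbol (hc : 0 < c) (hα : ∀ x : ℤ, |α x| ≤ C * Real.exp (-c * |(x : ℝ)|)) :
    AnalyticOnNhd ℝ (symbol α) Set.univ := by
  let strip : Set ℂ := {w | 2 * Real.pi * |w.im| < c / 2}
  have hstrip : IsOpen strip := isOpen_lt (by fun_prop) continuous_const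
  have hdiff : DifferentiableOn ℂ (complexFourierSeries α) strip :=
    Complex.differentiableOn_tsum_of_summable_norm
      ((summable_exp_neg_mul_abs_int (half_pos hc)).mul_left C) (fun x => by fun_prop) hstrip
      fun x w hw => norm_complexFourierSeries_term_le hα (le_of_lt hw) x
  have hreal : AnalyticOnNhd ℂ (complexFourierSeries α) (Complex.ofReal '' Set.univ) := by
    refine (hdiff.analyticOnNhd hstrip).mono ?_
    rintro _ ⟨s, -, rfl⟩
    simpa [strip] using hc
  have hsymbol : symbol α = fun s : ℝ => (complexFourierSeries α s).re := by
    simp only [complexFourierSeries_ofReal]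
    rfl
  rw [hsymbol]
  exact hreal.re_ofReal

lemma continuous_dispersion (hc : 0 < c)
    (hα : ∀ x : ℤ, |α x| ≤ C * Real.exp (-c * |(x : ℝ)|)) : Continuous (dispersion α) :=
  continuous_coinduced_dom.2
    (Real.continuous_sqrt.comp (continuousOn_univ.1 (analyticOnNhd_symbol hc hα).continuousOn))

end Symbol

section RegularPoints

lemma countable_setOf_deriv_eq_zero {f : ℝ → ℝ} (hf : AnalyticOnNhd ℝ f Set.univ) {a b : ℝ}
    (hab : f a ≠ f b) : {s | deriv f s = 0}.Countable := by
  obtain ⟨x, hx⟩ : ∃ x, deriv f x ≠ 0 := by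
    by_contra! hzero
    exact hab (is_const_of_deriv_eq_zero (fun x => (hf x trivial).differentiableAt) hzero a b)
  have hdiscrete := (mem_codiscrete'.1 (hf.deriv.preimage_zero_mem_codiscrete hx)).2
  rw [← Set.preimage_compl, compl_compl] at hdiscrete
  exact (HereditarilyLindelofSpace.isLindelof _).countable_of_isDiscrete hdiscrete

lemma ae_torus_exists_mem_Ioo {N : Set ℝ} (hN : N.Countable) :
    ∀ᵐ k : Torus, ∃ s ∈ Set.Ioo (0 : ℝ) (1 / 2) \ N, k = s ∨ k = -s := by
  let Z : Set ℝ := N ∪ {0, 1 / 2}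
  have hZ : Z.Countable := hN.union (by simp)
  have hexc : ((fun s : ℝ => (s : Torus)) '' (Z ∪ -Z)).Countable :=
    (hZ.union (hZ.preimage neg_injective)).image _
  have : NullSingletonClass (volume : Measure Torus) :=
    ⟨fun k => by rw [← Metric.closedBall_zero, AddCircle.volume_closedBall]; simp⟩
  filter_upwards [hexc.ae_notMem volume] with k hk
  obtain ⟨s, hs, rfl⟩ : k ∈ (fun s : ℝ => (s : Torus)) '' Set.Ioc (-(1 / 2)) (-(1 / 2) + 1) :=
    (AddCircle.coe_image_Ioc_eq (1 : ℝ) (-(1 / 2))).symm ▸ Set.mem_univ k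
  have hsZ : s ∉ Z ∧ -s ∉ Z := by
    simpa [not_or] using fun h => hk ⟨s, h, rfl⟩
  simp only [Z, Set.mem_union, Set.mem_insert_iff, Set.mem_singleton_iff, not_or] at hsZ
  rcases lt_or_gt_of_ne hsZ.1.2.1 with h | h
  · exact ⟨-s, ⟨⟨by linarith, by linarith [hs.1]⟩, hsZ.2.1⟩, Or.inr (by simp)⟩
  · exact ⟨s, ⟨⟨h, lt_of_le_of_ne (by linarith [hs.2]) hsZ.1.2.2⟩, hsZ.1.1⟩, Or.inl rfl⟩

lemma exists_linear_separation {f : ℝ → ℝ} {S : Set ℝ} {s : ℝ} (hS : IsCompact S)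
    (hs : S ∈ 𝓝 s) (hf : ContinuousOn f S) (hinj : Set.InjOn f S) (hd : deriv f s ≠ 0) :
    ∃ c > 0, ∀ x ∈ S, c * |x - s| ≤ |f x - f s| := by
  have hsS : s ∈ S := mem_of_mem_nhds hs
  have hcont : ContinuousOn (fun x => |dslope f s x|) S :=
    ((continuousOn_dslope hs).2 ⟨hf, differentiableAt_of_deriv_ne_zero hd⟩).abs
  obtain ⟨y, hy, hmin⟩ := hS.exists_isMinOn ⟨s, hsS⟩ hcont
  have hne (x : ℝ) (hx : x ∈ S) : dslope f s x ≠ 0 := by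
    rcases eq_or_ne x s with rfl | hxs
    · rwa [dslope_same]
    · rw [dslope_of_ne _ hxs, slope_def_field]
      exact div_ne_zero (sub_ne_zero.2 (hinj.ne hx hsS hxs)) (sub_ne_zero.2 hxs)
  refine ⟨_, abs_pos.2 (hne y hy), fun x hx => ?_⟩
  rw [← sub_smul_dslope f s x, smul_eq_mul, abs_mul, mul_comm]
  exact mul_le_mul_of_nonneg_left (hmin hx) (abs_nonneg _)

end RegularPoints

section UnimodalDispersion

variable {α : ℤ → ℝ} {s : ℝ}

lemma dispersion_pos
    (hmono : StrictMonoOn (fun s : ℝ => dispersion α (s : Torus)) (Set.Icc 0 (1 / 2)))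
    (hs : s ∈ Set.Ioc 0 (1 / 2)) : 0 < dispersion α (s : Torus) :=
  (Real.sqrt_nonneg _).trans_lt
    (hmono (by norm_num) (Set.Ioc_subset_Icc_self hs) hs.1)

lemma dispersion_sq_eq_symbol (hs : 0 < dispersion α (s : Torus)) :
    dispersion α (s : Torus) ^ 2 = symbol α s :=
  Real.sq_sqrt (Real.sqrt_pos.1 hs).le

lemma injOn_dispersion_sq
    (hmono : StrictMonoOn (fun s : ℝ => dispersion α (s : Torus)) (Set.Icc 0 (1 / 2))) :
    Set.InjOn (fun s : ℝ => dispersion α (s : Torus) ^ 2) (Set.Icc 0 (1 / 2)) :=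
  fun _ hs _ ht h => hmono.injOn hs ht
    ((sq_eq_sq₀ (Real.sqrt_nonneg _) (Real.sqrt_nonneg _)).1 h)

lemma dispersion_sq_eventuallyEq_symbol
    (hmono : StrictMonoOn (fun s : ℝ => dispersion α (s : Torus)) (Set.Icc 0 (1 / 2)))
    (hs : s ∈ Set.Ioo 0 (1 / 2)) :
    (fun s : ℝ => dispersion α (s : Torus) ^ 2) =ᶠ[𝓝 s] symbol α := by
  filter_upwards [Ioo_mem_nhds hs.1 hs.2] with x hx
  exact dispersion_sq_eq_symbol (dispersion_pos hmono (Set.Ioo_subset_Ioc_self hx))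

lemma countable_setOf_deriv_symbol_eq_zero {C c : ℝ} (hc : 0 < c)
    (hα : ∀ x : ℤ, |α x| ≤ C * Real.exp (-c * |(x : ℝ)|))
    (hmono : StrictMonoOn (fun s : ℝ => dispersion α (s : Torus)) (Set.Icc 0 (1 / 2))) :
    {s | deriv (symbol α) s = 0}.Countable :=
  countable_setOf_deriv_eq_zero (analyticOnNhd_symbol hc hα) (a := 0) (b := 1 / 2) fun h =>
    (hmono (by norm_num) (by norm_num) (by norm_num : (0 : ℝ) < 1 / 2)).ne (congrArg Real.sqrt h)

end UnimodalDispersion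

section PolesInHalfPlane

lemma inv_mul_le_of_linear_growth {c p q y : ℝ} (hc : 0 < c) (hp : c * (1 + |y|) ≤ p)
    (hq : c * (1 + |y|) ≤ q) : (p * q)⁻¹ ≤ (c ^ 2)⁻¹ * (1 + y ^ 2)⁻¹ := by
  have hlin : 0 ≤ c * (1 + |y|) := by positivity
  rw [← mul_inv]
  refine inv_anti₀ (by positivity) ?_
  calc c ^ 2 * (1 + y ^ 2) ≤ c ^ 2 * (1 + |y|) ^ 2 := by
        rw [← sq_abs y]
        gcongr
        nlinarith [abs_nonneg y]
    _ = c * (1 + |y|) * (c * (1 + |y|)) := by ring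
    _ ≤ p * q := mul_le_mul hp hq hlin (hlin.trans hp)

lemma exists_linear_growth {u v M : ℝ} (hu : 0 < u) (hv : 0 < v) (hM : 0 ≤ M) :
    ∃ c > 0, ∀ N y : ℝ, u ≤ N → v * |y| - M ≤ N → c * (1 + |y|) ≤ N := by
  refine ⟨(1 / u + (1 + M / u) / v)⁻¹, by positivity, fun N y hN hy => ?_⟩
  have hone : 1 ≤ 1 / u * N := by
    rw [one_div_mul_eq_div]
    exact (one_le_div hu).2 hN
  have habs : |y| ≤ (1 + M / u) / v * N := by
    have hMN : M ≤ M * (1 / u * N) := le_mul_of_one_le_right hM hone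
    rw [div_mul_eq_mul_div, le_div_iff₀ hv]
    linear_combination hMN + hy
  rw [inv_mul_le_iff₀ (by positivity)]
  linear_combination hone + habs

variable {z z₁ z₂ : ℂ}

lemma ofReal_sub_ne_zero (hz : 0 < z.im) (x : ℝ) : (x : ℂ) - z ≠ 0 :=
  sub_ne_zero.2 fun h => hz.ne' (by rw [← h, Complex.ofReal_im])

lemma integrable_inv_sub_mul_sub (hz₁ : 0 < z₁.im) (hz₂ : 0 < z₂.im) :
    Integrable fun x : ℝ => (((x : ℂ) - z₁) * (x - z₂))⁻¹ := by
  obtain ⟨c, hc, hgrowth⟩ := exists_linear_growth (lt_min hz₁ hz₂) one_pos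
    (le_max_of_le_left (abs_nonneg _) : 0 ≤ max |z₁.re| |z₂.re|)
  have him (z : ℂ) (x : ℝ) : z.im ≤ ‖(x : ℂ) - z‖ := by
    simpa using (neg_le_abs _).trans (Complex.abs_im_le_norm ((x : ℂ) - z))
  have hre (z : ℂ) (x : ℝ) : |x| - |z.re| ≤ ‖(x : ℂ) - z‖ := by
    simpa using (abs_sub_abs_le_abs_sub _ _).trans (Complex.abs_re_le_norm ((x : ℂ) - z))
  have hcont : Continuous fun x : ℝ => (((x : ℂ) - z₁) * (x - z₂))⁻¹ :=
    Continuous.inv₀ (by fun_prop) fun x =>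
      mul_ne_zero (ofReal_sub_ne_zero hz₁ x) (ofReal_sub_ne_zero hz₂ x)
  refine (integrable_inv_one_add_sq.const_mul (c ^ 2)⁻¹).mono' hcont.aestronglyMeasurable
    (Eventually.of_forall fun x => ?_)
  rw [norm_inv, norm_mul]
  refine inv_mul_le_of_linear_growth hc (hgrowth _ _ ((min_le_left _ _).trans (him z₁ x)) ?_)
    (hgrowth _ _ ((min_le_right _ _).trans (him z₂ x)) ?_)
  · linarith [hre z₁ x, le_max_left |z₁.re| |z₂.re|]
  · linarith [hre z₂ x, le_max_right |z₁.re| |z₂.re|]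

lemma tendsto_inv_ofReal_sub_cobounded (z : ℂ) :
    Tendsto (fun x : ℝ => ((x : ℂ) - z)⁻¹) (Bornology.cobounded ℝ) (𝓝 0) :=
  tendsto_inv₀_cobounded.comp
    ((tendsto_sub_const_cobounded z).comp (RCLike.tendsto_ofReal_cobounded_cobounded ℂ))

lemma div_mem_slitPlane (hz₁ : z₁.im < 0) (hz₂ : z₂.im < 0) : z₁ / z₂ ∈ Complex.slitPlane := by
  rw [Complex.mem_slitPlane_iff_not_le_zero]
  intro hle
  obtain ⟨hre, him⟩ := Complex.le_def.1 hle
  have hz₂₀ : z₂ ≠ 0 := fun h => hz₂.ne (by rw [h, Complex.zero_im])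
  have him₁ : z₁.im = (z₁ / z₂).re * z₂.im := by
    conv_lhs => rw [← div_mul_cancel₀ z₁ hz₂₀, Complex.mul_im, him, Complex.zero_im, zero_mul,
      add_zero]
  exact hz₁.not_ge (him₁ ▸ mul_nonneg_of_nonpos_of_nonpos hre hz₂.le)

lemma exists_antiderivative_inv_sub_mul_sub (hz₁ : 0 < z₁.im) (hz₂ : 0 < z₂.im) :
    ∃ F : ℝ → ℂ, (∀ x : ℝ, HasDerivAt F (((x : ℂ) - z₁) * (x - z₂))⁻¹ x) ∧
      Tendsto F (Bornology.cobounded ℝ) (𝓝 0) := by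
  have hsub (z : ℂ) (x : ℝ) : HasDerivAt (fun x : ℝ => (x : ℂ) - z) 1 x :=
    Complex.ofRealCLM.hasDerivAt.sub_const z
  rcases eq_or_ne z₁ z₂ with rfl | hne
  · refine ⟨fun x => -((x : ℂ) - z₁)⁻¹, fun x => ?_, ?_⟩
    · refine ((hsub z₁ x).inv (ofReal_sub_ne_zero hz₁ x)).neg.congr_deriv ?_
      rw [neg_div, neg_neg, one_div, sq]
    · simpa only [neg_zero] using (tendsto_inv_ofReal_sub_cobounded z₁).neg
  · have hratio : Tendsto (fun x : ℝ => ((x : ℂ) - z₁) / (x - z₂)) (Bornology.cobounded ℝ)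
        (𝓝 1) := by
      have h := ((tendsto_inv_ofReal_sub_cobounded z₂).const_mul (z₂ - z₁)).const_add 1
      rw [mul_zero, add_zero] at h
      refine h.congr fun x => ?_
      have := ofReal_sub_ne_zero hz₂ x
      field_simp
      ring
    refine ⟨fun x => Complex.log (((x : ℂ) - z₁) / (x - z₂)) / (z₁ - z₂), fun x => ?_, ?_⟩
    · have hslit : ((x : ℂ) - z₁) / (x - z₂) ∈ Complex.slitPlane :=
        div_mem_slitPlane (by simpa using hz₁) (by simpa using hz₂)
      have h₁ := ofReal_sub_ne_zero hz₁ x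
      have h₂ := ofReal_sub_ne_zero hz₂ x
      have h₁₂ := sub_ne_zero.2 hne
      refine ((((hsub z₁ x).div (hsub z₂ x) h₂).clog_real hslit).div_const _).congr_deriv ?_
      simp only [Pi.div_apply]
      field_simp
      ring
    · simpa only [Complex.log_one, zero_div] using
        (hratio.clog Complex.one_mem_slitPlane).div_const (z₁ - z₂)

lemma integral_inv_sub_mul_sub_eq_zero (hz₁ : 0 < z₁.im) (hz₂ : 0 < z₂.im) :
    ∫ x : ℝ, (((x : ℂ) - z₁) * (x - z₂))⁻¹ = 0 := by
  obtain ⟨F, hF, hlim⟩ := exists_antiderivative_inv_sub_mul_sub hz₁ hz₂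
  rw [IsOrderBornology.cobounded_eq, tendsto_sup] at hlim
  rw [integral_of_hasDerivAt_of_tendsto hF (integrable_inv_sub_mul_sub hz₁ hz₂) hlim.1 hlim.2,
    sub_zero]

lemma integral_comp_mul_inv_sub_mul_sub_eq_zero (d : ℝ) (hz₁ : 0 < z₁.im) (hz₂ : 0 < z₂.im) :
    ∫ x : ℝ, (((d * x : ℝ) - z₁) * ((d * x : ℝ) - z₂) : ℂ)⁻¹ = 0 := by
  rw [Measure.integral_comp_mul_left (fun x : ℝ => (((x : ℂ) - z₁) * (x - z₂))⁻¹),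
    integral_inv_sub_mul_sub_eq_zero hz₁ hz₂, smul_zero]

end PolesInHalfPlane

section BlowUp

variable {κ ω : ℝ}

/-- The spectral parameter `ε κ - i ω`, approaching the imaginary axis as `ε` tends to `0`. -/
noncomputable def ray (κ ω ε : ℝ) : ℂ := (ε * κ : ℝ) - I * (ω : ℂ)

lemma re_ray_pos {ε : ℝ} (hκ : 0 < κ) (hε : 0 < ε) (ω : ℝ) : 0 < (ray κ ω ε).re := by
  simpa [ray] using mul_pos hε hκ

lemma tendsto_ray (κ ω : ℝ) : Tendsto (ray κ ω) (𝓝[>] 0) (𝓝 (-I * ω)) := by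
  have hcont : Continuous (ray κ ω) := by
    unfold ray
    fun_prop
  simpa [ray] using (hcont.tendsto 0).mono_left nhdsWithin_le_nhds

/-- The characteristic polynomial on the ray `ε κ - i ω`, for damping `ε b`, divided by `ε`. -/
noncomputable def scaledDenom (b φ κ ω ε : ℝ) : ℂ :=
  ((φ - ω ^ 2) / ε + ε * (κ ^ 2 + 2 * b * κ) : ℝ) - I * (2 * ω * (κ + b) : ℝ)

lemma charDenom_ray (b φ κ ω : ℝ) {ε : ℝ} (hε : ε ≠ 0) :
    charDenom (ε * b) φ (ray κ ω ε) = ε * scaledDenom b φ κ ω ε := by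
  have hεc : (ε : ℂ) ≠ 0 := Complex.ofReal_ne_zero.2 hε
  rw [charDenom, ray, scaledDenom]
  push_cast
  field_simp
  linear_combination (ω : ℂ) ^ 2 * Complex.I_sq

lemma two_mul_mul_le_norm_scaledDenom {b φ ε : ℝ} (hω : 0 ≤ ω) (hb : 0 ≤ b) :
    2 * ω * κ ≤ ‖scaledDenom b φ κ ω ε‖ := by
  have him : (scaledDenom b φ κ ω ε).im = -(2 * ω * (κ + b)) := by
    rw [scaledDenom, Complex.sub_im, Complex.ofReal_im, Complex.I_mul_im, Complex.ofReal_re,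
      zero_sub]
  calc 2 * ω * κ ≤ 2 * ω * (κ + b) := by
        gcongr
        linarith
    _ ≤ |(scaledDenom b φ κ ω ε).im| := by
        rw [him, abs_neg]
        exact le_abs_self _
    _ ≤ ‖scaledDenom b φ κ ω ε‖ := Complex.abs_im_le_norm _

lemma scaledDenom_ne_zero {b φ ε : ℝ} (hω : 0 < ω) (hκ : 0 < κ) (hb : 0 ≤ b) :
    scaledDenom b φ κ ω ε ≠ 0 :=
  norm_pos_iff.1
    ((by positivity : 0 < 2 * ω * κ).trans_le (two_mul_mul_le_norm_scaledDenom hω.le hb))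

lemma exists_linear_growth_scaledDenom {v B : ℝ} (hω : 0 < ω) (hκ : 0 < κ) (hv : 0 < v)
    (hB : 0 ≤ B) :
    ∃ c > 0, ∀ {ε b φ y : ℝ}, ε ∈ Set.Ioc 0 1 → b ∈ Set.Icc 0 B → v * |ε * y| ≤ |φ - ω ^ 2| →
      c * (1 + |y|) ≤ ‖scaledDenom b φ κ ω ε‖ := by
  obtain ⟨c, hc, hgrowth⟩ := exists_linear_growth (u := 2 * ω * κ) (M := κ ^ 2 + 2 * B * κ)
    (by positivity) hv (by positivity)
  refine ⟨c, hc, fun {ε b φ y} hε hb hφ => hgrowth _ _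
    (two_mul_mul_le_norm_scaledDenom hω.le hb.1) ?_⟩
  have hre : (scaledDenom b φ κ ω ε).re = (φ - ω ^ 2) / ε + ε * (κ ^ 2 + 2 * b * κ) := by
    rw [scaledDenom, Complex.sub_re, Complex.ofReal_re, Complex.I_mul_re, Complex.ofReal_im,
      neg_zero, sub_zero]
  have hmain : v * |y| ≤ |(φ - ω ^ 2) / ε| := by
    rw [abs_div, abs_of_pos hε.1, le_div_iff₀ hε.1]
    rwa [abs_mul, abs_of_pos hε.1, mul_left_comm, mul_comm] at hφ
  have hrest₀ : 0 ≤ ε * (κ ^ 2 + 2 * b * κ) :=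
    mul_nonneg hε.1.le (add_nonneg (sq_nonneg κ) (mul_nonneg (mul_nonneg two_pos.le hb.1) hκ.le))
  have hrest : ε * (κ ^ 2 + 2 * b * κ) ≤ κ ^ 2 + 2 * B * κ :=
    calc ε * (κ ^ 2 + 2 * b * κ) ≤ ε * (κ ^ 2 + 2 * B * κ) := by
          have := hε.1
          have := hb.2
          gcongr
      _ ≤ κ ^ 2 + 2 * B * κ := mul_le_of_le_one_left (by positivity) hε.2
  calc v * |y| - (κ ^ 2 + 2 * B * κ)
      ≤ |(φ - ω ^ 2) / ε| - |ε * (κ ^ 2 + 2 * b * κ)| := by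
        rw [abs_of_nonneg hrest₀]
        exact sub_le_sub hmain hrest
    _ ≤ |(scaledDenom b φ κ ω ε).re| := by
        rw [hre]
        exact abs_sub_abs_le_abs_add _ _
    _ ≤ ‖scaledDenom b φ κ ω ε‖ := Complex.abs_re_le_norm _

/-- The effect of a damping `ε b` on the resolvent along the ray `ε κ - i ω`, weighted by the
Jacobian `ε` of the blow-up `x = s + ε y`. -/
noncomputable def scaledResolventGap (b φ κ ω ε : ℝ) : ℂ :=
  ε * (resolvent (ε * b) φ (ray κ ω ε) - resolvent 0 φ (ray κ ω ε))

lemma scaledResolventGap_eq {b φ ε : ℝ} (hω : 0 < ω) (hκ : 0 < κ) (hb : 0 ≤ b) (hε : ε ≠ 0) :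
    scaledResolventGap b φ κ ω ε =
      -2 * b * ray κ ω ε ^ 2 * (scaledDenom b φ κ ω ε * scaledDenom 0 φ κ ω ε)⁻¹ := by
  have hεc : (ε : ℂ) ≠ 0 := Complex.ofReal_ne_zero.2 hε
  have hb₁ := scaledDenom_ne_zero (φ := φ) (ε := ε) hω hκ hb
  have hb₀ := scaledDenom_ne_zero (φ := φ) (ε := ε) hω hκ le_rfl
  have hdamped := charDenom_ray b φ κ ω hε
  have hundamped := charDenom_ray 0 φ κ ω hε
  have hdiff : scaledDenom 0 φ κ ω ε - scaledDenom b φ κ ω ε = -2 * b * ray κ ω ε := by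
    refine mul_left_cancel₀ hεc ?_
    rw [mul_sub, ← hdamped, ← hundamped, charDenom, charDenom]
    push_cast
    ring
  rw [mul_zero] at hundamped
  rw [scaledResolventGap, resolvent, resolvent, hdamped, hundamped]
  field_simp
  linear_combination ray κ ω ε * hdiff

lemma exists_norm_scaledResolventGap_le {v B : ℝ} (hω : 0 < ω) (hκ : 0 < κ) (hv : 0 < v)
    (hB : 0 ≤ B) :
    ∃ M ≥ 0, ∀ {ε b φ y : ℝ}, ε ∈ Set.Ioc 0 1 → b ∈ Set.Icc 0 B →
      v * |ε * y| ≤ |φ - ω ^ 2| → ‖scaledResolventGap b φ κ ω ε‖ ≤ M * (1 + y ^ 2)⁻¹ := by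
  obtain ⟨c, hc, hgrowth⟩ := exists_linear_growth_scaledDenom hω hκ hv hB
  refine ⟨2 * B * (κ + ω) ^ 2 * (c ^ 2)⁻¹, by positivity, fun {ε b φ y} hε hb hφ => ?_⟩
  have hray : ‖ray κ ω ε‖ ≤ κ + ω :=
    calc ‖ray κ ω ε‖ ≤ ε * κ + ω := by
          simpa [ray, abs_of_pos hε.1, abs_of_pos hκ, abs_of_pos hω] using
            norm_sub_le ((ε * κ : ℝ) : ℂ) (I * ω)
      _ ≤ κ + ω := by
          have := mul_le_of_le_one_left hκ.le hε.2
          gcongr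
  have hprefactor : ‖(-2 * b * ray κ ω ε ^ 2 : ℂ)‖ ≤ 2 * B * (κ + ω) ^ 2 := by
    rw [norm_mul, norm_mul, norm_pow, norm_neg, Complex.norm_real, Real.norm_of_nonneg hb.1,
      Complex.norm_ofNat]
    have := hb.2
    gcongr
  rw [scaledResolventGap_eq hω hκ hb.1 hε.1.ne', norm_mul, norm_inv, norm_mul (scaledDenom ..),
    mul_assoc (2 * B * (κ + ω) ^ 2)]
  exact mul_le_mul hprefactor (inv_mul_le_of_linear_growth hc (hgrowth hε hb hφ)
    (hgrowth hε ⟨le_rfl, hB⟩ hφ)) (by positivity) (by positivity)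

variable {f b : ℝ → ℝ} {s : ℝ}

lemma tendsto_add_mul_nhdsGT (s y : ℝ) : Tendsto (fun ε : ℝ => s + ε * y) (𝓝[>] 0) (𝓝 s) := by
  have hcont : Continuous fun ε : ℝ => s + ε * y := by fun_prop
  simpa using (hcont.tendsto 0).mono_left nhdsWithin_le_nhds

lemma tendsto_scaledDenom (hf : DifferentiableAt ℝ f s) (hfs : f s = ω ^ 2)
    (hb : ContinuousAt b s) (y : ℝ) :
    Tendsto (fun ε => scaledDenom (b (s + ε * y)) (f (s + ε * y)) κ ω ε) (𝓝[>] 0)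
      (𝓝 ((deriv f s * y : ℝ) - I * (2 * ω * (κ + b s) : ℝ))) := by
  have hquot : Tendsto (fun ε : ℝ => (f (s + ε * y) - ω ^ 2) / ε) (𝓝[>] 0)
      (𝓝 (deriv f s * y)) := by
    have hline : HasDerivAt (fun ε : ℝ => s + ε * y) y 0 := by
      simpa using ((hasDerivAt_id (0 : ℝ)).mul_const y).const_add s
    have hcomp := (hf.hasDerivAt.comp_of_eq (0 : ℝ) hline (by simp)).tendsto_slope_zero_right
    refine hcomp.congr fun ε => ?_
    simp [hfs, div_eq_inv_mul]
  have hbs := hb.tendsto.comp (tendsto_add_mul_nhdsGT s y)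
  have hid : Tendsto (fun ε : ℝ => ε) (𝓝[>] 0) (𝓝 0) := nhdsWithin_le_nhds
  have hre := hquot.add (hid.mul (((hbs.const_mul 2).mul_const κ).const_add (κ ^ 2)))
  rw [zero_mul, add_zero] at hre
  have him := (hbs.const_add κ).const_mul (2 * ω)
  exact hre.ofReal.sub (him.ofReal.const_mul I)

/-- The limit of `scaledResolventGap` under the blow-up `x = s + ε y`. -/
noncomputable def limitingGap (b d κ ω y : ℝ) : ℂ :=
  -2 * b * (-I * ω) ^ 2 *
    (((d * y : ℝ) - I * (2 * ω * (κ + b) : ℝ)) * ((d * y : ℝ) - I * (2 * ω * κ : ℝ)))⁻¹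

lemma tendsto_scaledResolventGap (hω : 0 < ω) (hκ : 0 < κ) (hf : DifferentiableAt ℝ f s)
    (hfs : f s = ω ^ 2) (hb : ContinuousAt b s) (hb₀ : ∀ x, 0 ≤ b x) (y : ℝ) :
    Tendsto (fun ε => scaledResolventGap (b (s + ε * y)) (f (s + ε * y)) κ ω ε) (𝓝[>] 0)
      (𝓝 (limitingGap (b s) (deriv f s) κ ω y)) := by
  have hbs := (hb.tendsto.comp (tendsto_add_mul_nhdsGT s y)).ofReal
  have hdamped := tendsto_scaledDenom (κ := κ) hf hfs hb y
  have hundamped := tendsto_scaledDenom (κ := κ) hf hfs (continuousAt_const (y := (0 : ℝ))) y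
  rw [add_zero] at hundamped
  have hne (r : ℝ) (hr : 0 < r) : ((deriv f s * y : ℝ) - I * (r : ℂ)) ≠ 0 :=
    ofReal_sub_ne_zero (by simpa using hr) _
  have hbpos : 0 < κ + b s := add_pos_of_pos_of_nonneg hκ (hb₀ s)
  refine (((hbs.const_mul (-2)).mul ((tendsto_ray κ ω).pow 2)).mul
    ((hdamped.mul hundamped).inv₀ (mul_ne_zero (hne _ (by positivity))
      (hne _ (by positivity))))).congr' ?_
  filter_upwards [self_mem_nhdsWithin] with ε hε
  exact (scaledResolventGap_eq hω hκ (hb₀ _) (ne_of_gt hε)).symm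

lemma integral_limitingGap {b : ℝ} (hω : 0 < ω) (hκ : 0 < κ) (hb : 0 ≤ b) (d : ℝ) :
    ∫ y, limitingGap b d κ ω y = 0 := by
  have him (r : ℝ) : (I * (r : ℂ)).im = r := by simp
  unfold limitingGap
  rw [integral_const_mul, integral_comp_mul_inv_sub_mul_sub_eq_zero d
    (by rw [him]; positivity) (by rw [him]; positivity), mul_zero]

lemma setIntegral_eq_integral_rescaled {E : Type*} [NormedAddCommGroup E] [NormedSpace ℝ E]
    {S : Set ℝ} (hS : MeasurableSet S) (g : ℝ → E) (s : ℝ) {ε : ℝ} (hε : 0 < ε) :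
    ∫ x in S, g x = ∫ y, ε • S.indicator g (s + ε * y) := by
  rw [integral_smul, Measure.integral_comp_mul_left (fun y => S.indicator g (s + y)),
    integral_add_left_eq_self (S.indicator g) s, abs_of_pos (inv_pos.2 hε), smul_inv_smul₀ hε.ne',
    integral_indicator hS]

lemma exists_norm_indicator_scaledResolventGap_le {S : Set ℝ} (hω : 0 < ω) (hκ : 0 < κ)
    (hS : IsCompact S) (hs : S ∈ 𝓝 s) (hf : ContinuousOn f S) (hinj : Set.InjOn f S)
    (hfs : f s = ω ^ 2) (hd : deriv f s ≠ 0) (hb : ContinuousOn b S) (hb₀ : ∀ x ∈ S, 0 ≤ b x) :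
    ∃ M, ∀ ε ∈ Set.Ioc (0 : ℝ) 1, ∀ y,
      ‖S.indicator (fun x => scaledResolventGap (b x) (f x) κ ω ε) (s + ε * y)‖ ≤
        M * (1 + y ^ 2)⁻¹ := by
  obtain ⟨v, hv, hsep⟩ := exists_linear_separation hS hs hf hinj hd
  obtain ⟨B, hB⟩ := hS.exists_bound_of_continuousOn hb
  have hB₀ : 0 ≤ B := (norm_nonneg _).trans (hB s (mem_of_mem_nhds hs))
  obtain ⟨M, hM, hbound⟩ := exists_norm_scaledResolventGap_le hω hκ hv hB₀
  refine ⟨M, fun ε hε y => ?_⟩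
  by_cases hy : s + ε * y ∈ S
  · have hsepy := hsep _ hy
    rw [add_sub_cancel_left, hfs] at hsepy
    rw [Set.indicator_of_mem hy]
    exact hbound hε ⟨hb₀ _ hy, (le_abs_self _).trans (hB _ hy)⟩ hsepy
  · rw [Set.indicator_of_notMem hy, norm_zero]
    positivity

lemma tendsto_setIntegral_resolvent_sub {S : Set ℝ} (hω : 0 < ω) (hκ : 0 < κ) (hS : IsCompact S)
    (hs : S ∈ 𝓝 s) (hf : Continuous f) (hinj : Set.InjOn f S) (hfs : f s = ω ^ 2)
    (hd : deriv f s ≠ 0) (hb : Continuous b) (hb₀ : ∀ x, 0 ≤ b x) :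
    Tendsto (fun ε => ∫ x in S,
      (resolvent (ε * b x) (f x) (ray κ ω ε) - resolvent 0 (f x) (ray κ ω ε)))
      (𝓝[>] 0) (𝓝 0) := by
  obtain ⟨M, hM⟩ := exists_norm_indicator_scaledResolventGap_le hω hκ hS hs hf.continuousOn hinj
    hfs hd hb.continuousOn fun x _ => hb₀ x
  let gap (ε x : ℝ) : ℂ := S.indicator (fun x => scaledResolventGap (b x) (f x) κ ω ε) x
  have hmeas (ε : ℝ) : AEStronglyMeasurable fun y => gap ε (s + ε * y) := by
    have hgap : Measurable fun x => scaledResolventGap (b x) (f x) κ ω ε := by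
      unfold scaledResolventGap resolvent charDenom
      fun_prop
    exact ((hgap.indicator hS.measurableSet).comp
      (by fun_prop : Measurable fun y => s + ε * y)).aestronglyMeasurable
  have hdom : ∀ᶠ ε : ℝ in 𝓝[>] 0, ∀ᵐ y : ℝ, ‖gap ε (s + ε * y)‖ ≤ M * (1 + y ^ 2)⁻¹ := by
    filter_upwards [Ioc_mem_nhdsGT one_pos] with ε hε
    exact Eventually.of_forall (hM ε hε)
  have hpointwise (y : ℝ) : Tendsto (fun ε : ℝ => gap ε (s + ε * y)) (𝓝[>] 0)
      (𝓝 (limitingGap (b s) (deriv f s) κ ω y)) := by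
    refine (tendsto_scaledResolventGap hω hκ (differentiableAt_of_deriv_ne_zero hd) hfs
      hb.continuousAt hb₀ y).congr' ?_
    filter_upwards [(tendsto_add_mul_nhdsGT s y).eventually hs] with ε hε
    exact (Set.indicator_of_mem hε fun x => scaledResolventGap (b x) (f x) κ ω ε).symm
  have hlim := tendsto_integral_filter_of_dominated_convergence _ (Eventually.of_forall hmeas)
    hdom (integrable_inv_one_add_sq.const_mul M) (Eventually.of_forall hpointwise)
  rw [integral_limitingGap hω hκ (hb₀ s)] at hlim
  refine hlim.congr' ?_
  filter_upwards [self_mem_nhdsWithin] with ε hε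
  rw [setIntegral_eq_integral_rescaled hS.measurableSet _ s hε]
  simp only [← Set.indicator_const_smul_apply, Complex.real_smul]
  rfl

end BlowUp

section Torus

lemma integral_torus_eq_two_smul {E : Type*} [NormedAddCommGroup E] [NormedSpace ℝ E]
    {f : Torus → E} (hf : Continuous f) (heven : ∀ k, f (-k) = f k) :
    ∫ k, f k = (2 : ℝ) • ∫ x in Set.Icc (0 : ℝ) (1 / 2), f x := by
  have hint (a b : ℝ) : IntervalIntegrable (fun x : ℝ => f x) volume a b :=
    (hf.comp (AddCircle.continuous_mk' 1)).intervalIntegrable a b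
  have hneg : ∫ x in (-(1 / 2) : ℝ)..0, f x = ∫ x in (0 : ℝ)..(1 / 2), f x := by
    have h := intervalIntegral.integral_comp_neg (a := 0) (b := 1 / 2) fun x : ℝ => f x
    simpa only [AddCircle.coe_neg, heven, neg_zero] using h.symm
  rw [← UnitAddCircle.intervalIntegral_preimage (-(1 / 2)) f, neg_add_eq_sub, sub_half,
    ← intervalIntegral.integral_add_adjacent_intervals (hint _ 0) (hint 0 _), hneg, ← two_smul ℝ,
    intervalIntegral.integral_of_le (by norm_num), integral_Icc_eq_integral_Ioc]

lemma tendsto_averagedResolvent_sub {b ω : Torus → ℝ} {κ s : ℝ} (hb : Continuous b)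
    (hω : Continuous ω) (hb_even : ∀ k, b (-k) = b k) (hω_even : ∀ k, ω (-k) = ω k)
    (hb₀ : ∀ k, 0 ≤ b k) (hinj : Set.InjOn (fun x : ℝ => ω x ^ 2) (Set.Icc 0 (1 / 2)))
    (hs : s ∈ Set.Ioo 0 (1 / 2)) (hωs : 0 < ω s) (hd : deriv (fun x : ℝ => ω x ^ 2) s ≠ 0)
    (hκ : 0 < κ) :
    Tendsto (fun ε => averagedResolvent volume (fun k => ε * b k) ω (ray κ (ω s) ε) -
      averagedResolvent volume (fun _ => 0) ω (ray κ (ω s) ε)) (𝓝[>] 0) (𝓝 0) := by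
  have hcoe : Continuous fun x : ℝ => (x : Torus) := AddCircle.continuous_mk' 1
  have hline := (tendsto_setIntegral_resolvent_sub hωs hκ isCompact_Icc (Icc_mem_nhds hs.1 hs.2)
    ((hω.comp hcoe).pow 2) hinj rfl hd (hb.comp hcoe) fun x => hb₀ x).const_smul (2 : ℝ)
  rw [smul_zero] at hline
  refine hline.congr' ?_
  filter_upwards [self_mem_nhdsWithin] with ε hε
  have hz : 0 < (ray κ (ω s) ε).re := re_ray_pos hκ hε _
  have hcont (a : Torus → ℝ) (ha : Continuous a) (ha₀ : ∀ k, 0 ≤ a k) :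
      Continuous fun k => resolvent (a k) (ω k ^ 2) (ray κ (ω s) ε) := by
    refine continuous_const.div ?_ fun k => charDenom_ne_zero (ha₀ k) (sq_nonneg _) hz
    unfold charDenom
    fun_prop
  have hεb₀ (k : Torus) : 0 ≤ ε * b k := mul_nonneg hε.le (hb₀ k)
  rw [averagedResolvent_sub (by fun_prop) measurable_const hω.measurable hεb₀ (fun _ => le_rfl) hz]
  exact (integral_torus_eq_two_smul ((hcont _ (hb.const_mul ε) hεb₀).sub
    (hcont _ continuous_const fun _ => le_rfl)) fun k => by
      simp only [Pi.sub_apply, hb_even, hω_even]).symm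

variable {α : ℤ → ℝ} {γ₀ γ₁ C c : ℝ}

lemma tendsto_gTildeEps_sub_gTilde_ray {s κ : ℝ} (hγ₀ : 0 ≤ γ₀) (hγ₁ : 0 ≤ γ₁)
    (hω : Continuous (dispersion α))
    (hmono : StrictMonoOn (fun s : ℝ => dispersion α (s : Torus)) (Set.Icc 0 (1 / 2)))
    (hs : s ∈ Set.Ioo 0 (1 / 2)) (hd : deriv (symbol α) s ≠ 0) (hκ : 0 < κ) :
    Tendsto (fun ε => gTildeEps γ₀ γ₁ α ε (ray κ (dispersion α s) ε) -
      gTilde γ₁ α (ray κ (dispersion α s) ε)) (𝓝[>] 0) (𝓝 0) := by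
  have hlim := (tendsto_averagedResolvent_sub (continuous_scattering.const_mul γ₀) hω
    (fun k => by rw [scattering_neg]) (dispersion_neg α)
    (fun k => mul_nonneg hγ₀ (scattering_nonneg k)) (injOn_dispersion_sq hmono) hs
    (dispersion_pos hmono (Set.Ioo_subset_Ioc_self hs))
    (by rwa [(dispersion_sq_eventuallyEq_symbol hmono hs).deriv_eq]) hκ).norm.const_mul γ₁
  rw [norm_zero, mul_zero] at hlim
  refine squeeze_zero_norm' ?_ hlim
  filter_upwards [self_mem_nhdsWithin] with ε hε
  simpa only [mul_left_comm, mul_assoc] using norm_gTildeEps_sub_gTilde_le hω hγ₀ hγ₁ hε.le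
    (re_ray_pos hκ hε _)

lemma ae_tendsto_gTildeEps_sub_gTilde_ray (hγ₀ : 0 ≤ γ₀) (hγ₁ : 0 ≤ γ₁) (hc : 0 < c)
    (hα : ∀ x : ℤ, |α x| ≤ C * Real.exp (-c * |(x : ℝ)|))
    (hmono : StrictMonoOn (fun s : ℝ => dispersion α (s : Torus)) (Set.Icc 0 (1 / 2))) :
    ∀ᵐ k : Torus, ∀ κ > 0, Tendsto (fun ε => gTildeEps γ₀ γ₁ α ε (ray κ (dispersion α k) ε) -
      gTilde γ₁ α (ray κ (dispersion α k) ε)) (𝓝[>] 0) (𝓝 0) := by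
  filter_upwards [ae_torus_exists_mem_Ioo (countable_setOf_deriv_symbol_eq_zero hc hα hmono)]
    with k hk κ hκ
  obtain ⟨s, ⟨hs, hd⟩, hks⟩ := hk
  have hdisp : dispersion α k = dispersion α s := by
    rcases hks with rfl | rfl
    · rfl
    · exact dispersion_neg α s
  rw [hdisp]
  exact tendsto_gTildeEps_sub_gTilde_ray hγ₀ hγ₁ (continuous_dispersion hc hα) hmono hs hd hκ

end Torus

section Remainder

variable {α : ℤ → ℝ} {γ₀ γ₁ : ℝ} {K : Torus → ℝ} {p : ℝ}

lemma aemeasurable_ray (hω : Continuous (dispersion α)) (hK : AEMeasurable K) (ε : ℝ) :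
    AEMeasurable fun k => ray (K k) (dispersion α k) ε := by
  have hω' := hω.measurable.aemeasurable (μ := volume)
  unfold ray
  fun_prop

lemma norm_rTilde_rpow {ε : ℝ} (hε : 0 < ε) (z : ℂ) :
    ‖rTilde γ₀ γ₁ α ε z‖ ^ p = (ε ^ p)⁻¹ * ‖gTildeEps γ₀ γ₁ α ε z - gTilde γ₁ α z‖ ^ p := by
  rw [rTilde, norm_div, Complex.norm_real, Real.norm_of_nonneg hε.le,
    Real.div_rpow (norm_nonneg _) hε.le, div_eq_inv_mul]

lemma aestronglyMeasurable_norm_gTildeEps_sub_gTilde_rpow (hω : Continuous (dispersion α))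
    (hK : AEMeasurable K) (ε : ℝ) :
    AEStronglyMeasurable fun k => ‖gTildeEps γ₀ γ₁ α ε (ray (K k) (dispersion α k) ε) -
      gTilde γ₁ α (ray (K k) (dispersion α k) ε)‖ ^ p :=
  ((((measurable_gTildeEps hω).comp_aemeasurable (aemeasurable_ray hω hK ε)).sub
    ((measurable_gTilde hω).comp_aemeasurable (aemeasurable_ray hω hK ε))).norm.pow_const
      p).aestronglyMeasurable

lemma norm_gTildeEps_sub_gTilde_rpow_le (hω : Continuous (dispersion α)) (hγ₀ : 0 ≤ γ₀)
    (hγ₁ : 0 ≤ γ₁) (hp : 0 ≤ p) {ε : ℝ} (hε : 0 ≤ ε) {z : ℂ} (hz : 0 < z.re) :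
    ‖‖gTildeEps γ₀ γ₁ α ε z - gTilde γ₁ α z‖ ^ p‖ ≤ 2 ^ p := by
  rw [Real.norm_of_nonneg (by positivity)]
  exact Real.rpow_le_rpow (norm_nonneg _)
    (norm_gTildeEps_sub_gTilde_le_two hω hγ₀ hγ₁ hε hz) hp

lemma integrable_norm_rTilde_rpow (hω : Continuous (dispersion α)) (hγ₀ : 0 ≤ γ₀)
    (hγ₁ : 0 ≤ γ₁) (hK : AEMeasurable K) (hK₀ : ∀ᵐ k, 0 < K k) (hp : 0 ≤ p) {ε : ℝ}
    (hε : 0 < ε) :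
    Integrable fun k => ‖rTilde γ₀ γ₁ α ε (ray (K k) (dispersion α k) ε)‖ ^ p := by
  simp only [norm_rTilde_rpow hε]
  refine (Integrable.of_bound (aestronglyMeasurable_norm_gTildeEps_sub_gTilde_rpow hω hK ε)
    (2 ^ p) ?_).const_mul _
  filter_upwards [hK₀] with k hk
  exact norm_gTildeEps_sub_gTilde_rpow_le hω hγ₀ hγ₁ hp hε.le (re_ray_pos hk hε _)

lemma tendsto_integral_norm_gTildeEps_sub_gTilde_rpow (hω : Continuous (dispersion α))
    (hγ₀ : 0 ≤ γ₀) (hγ₁ : 0 ≤ γ₁) (hK : AEMeasurable K) (hK₀ : ∀ᵐ k, 0 < K k) (hp : 0 < p)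
    (hlim : ∀ᵐ k : Torus, ∀ κ > 0,
      Tendsto (fun ε => gTildeEps γ₀ γ₁ α ε (ray κ (dispersion α k) ε) -
        gTilde γ₁ α (ray κ (dispersion α k) ε)) (𝓝[>] 0) (𝓝 0)) :
    Tendsto (fun ε => ∫ k, ‖gTildeEps γ₀ γ₁ α ε (ray (K k) (dispersion α k) ε) -
      gTilde γ₁ α (ray (K k) (dispersion α k) ε)‖ ^ p) (𝓝[>] 0) (𝓝 0) := by
  have hbound : ∀ᶠ ε in 𝓝[>] 0, ∀ᵐ k, ‖‖gTildeEps γ₀ γ₁ α ε (ray (K k) (dispersion α k) ε) -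
      gTilde γ₁ α (ray (K k) (dispersion α k) ε)‖ ^ p‖ ≤ 2 ^ p := by
    filter_upwards [self_mem_nhdsWithin] with ε hε
    filter_upwards [hK₀] with k hk
    exact norm_gTildeEps_sub_gTilde_rpow_le hω hγ₀ hγ₁ hp.le (le_of_lt hε) (re_ray_pos hk hε _)
  have hpointwise : ∀ᵐ k, Tendsto (fun ε => ‖gTildeEps γ₀ γ₁ α ε (ray (K k) (dispersion α k) ε) -
      gTilde γ₁ α (ray (K k) (dispersion α k) ε)‖ ^ p) (𝓝[>] 0) (𝓝 0) := by
    filter_upwards [hlim, hK₀] with k hk hk₀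
    simpa only [norm_zero, Real.zero_rpow hp.ne'] using
      (hk _ hk₀).norm.rpow_const (Or.inr hp.le)
  simpa only [integral_zero] using tendsto_integral_filter_of_dominated_convergence
    (f := fun _ => (0 : ℝ)) (fun _ => 2 ^ p)
    (Eventually.of_forall (aestronglyMeasurable_norm_gTildeEps_sub_gTilde_rpow hω hK))
    hbound (integrable_const _) hpointwise

end Remainder

end HarmonicChain

theorem proposition3p1_general {γ₀ γ₁ : ℝ} (hγ₀ : 0 ≤ γ₀) (hγ₁ : 0 ≤ γ₁) {α : ℤ → ℝ} {C c : ℝ}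
    (hc : 0 < c) (hα : ∀ x : ℤ, |α x| ≤ C * Real.exp (-c * |(x : ℝ)|))
    (hmono : StrictMonoOn (fun s : ℝ => HarmonicChain.dispersion α (s : HarmonicChain.Torus))
      (Set.Icc 0 (1 / 2)))
    {K : HarmonicChain.Torus → ℝ} (hK : AEMeasurable K) (hK₀ : ∀ᵐ k, 0 < K k)
    {p : ℝ} (hp : 0 < p) :
    (∀ ε : ℝ, 0 < ε → Integrable (fun k : HarmonicChain.Torus =>
      ‖HarmonicChain.rTilde γ₀ γ₁ α ε
        ((ε * K k : ℝ) - Complex.I * (HarmonicChain.dispersion α k : ℂ))‖ ^ p)) ∧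
    Tendsto (fun ε : ℝ => ε ^ p * ∫ k : HarmonicChain.Torus,
      ‖HarmonicChain.rTilde γ₀ γ₁ α ε
        ((ε * K k : ℝ) - Complex.I * (HarmonicChain.dispersion α k : ℂ))‖ ^ p)
      (𝓝[>] 0) (𝓝 0) := by
  have hω := HarmonicChain.continuous_dispersion hc hα
  refine ⟨fun ε hε => HarmonicChain.integrable_norm_rTilde_rpow hω hγ₀ hγ₁ hK hK₀ hp.le hε, ?_⟩
  refine (HarmonicChain.tendsto_integral_norm_gTildeEps_sub_gTilde_rpow hω hγ₀ hγ₁ hK hK₀ hp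
    (HarmonicChain.ae_tendsto_gTildeEps_sub_gTilde_ray hγ₀ hγ₁ hc hα hmono)).congr' ?_
  filter_upwards [self_mem_nhdsWithin] with ε hε
  have hεp : ε ^ p ≠ 0 := (Real.rpow_pos_of_pos hε p).ne'
  simp only [HarmonicChain.norm_rTilde_rpow hε, integral_const_mul, mul_inv_cancel_left₀ hεp]
  rfl

theorem proposition3p1
    (γ₀ γ₁ : ℝ) (hγ₀ : 0 < γ₀) (hγ₁ : 0 < γ₁)
    (α : ℤ → ℝ) (hα : HarmonicChain.IsAdmissibleCoupling α)
    (K : HarmonicChain.Torus → ℝ) (hK_uc : UniformContinuous K)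
    (hK_bdd : ∃ C : ℝ, ∀ k, K k ≤ C) (hK_pos : ∀ k, 0 < K k) (hK_inf : 0 < ⨅ k, K k) :
    (∀ ε : ℝ, 0 < ε → ∀ z : ℂ, 0 < z.re →
      HarmonicChain.gTildeEps γ₀ γ₁ α ε z =
        HarmonicChain.gTilde γ₁ α z + (ε : ℂ) * HarmonicChain.rTilde γ₀ γ₁ α ε z) ∧
    ∀ p : ℝ, 1 ≤ p →
      (∀ ε : ℝ, 0 < ε → Integrable (fun k : HarmonicChain.Torus =>
        ‖HarmonicChain.rTilde γ₀ γ₁ α ε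
          ((ε * K k : ℝ) - Complex.I * (HarmonicChain.dispersion α k : ℂ))‖ ^ p)) ∧
      Tendsto (fun ε : ℝ => ε ^ p * ∫ k : HarmonicChain.Torus,
        ‖HarmonicChain.rTilde γ₀ γ₁ α ε
          ((ε * K k : ℝ) - Complex.I * (HarmonicChain.dispersion α k : ℂ))‖ ^ p)
        (𝓝[>] 0) (𝓝 0) := by
  obtain ⟨C, hC, hα_decay⟩ := hα.exp_decay
  have hdecay : ∀ x : ℤ, |α x| ≤ C * Real.exp (-C⁻¹ * |(x : ℝ)|) := fun x => by
    simpa only [neg_mul, mul_neg, div_eq_inv_mul] using hα_decay x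
  exact ⟨fun ε hε z _ => HarmonicChain.gTildeEps_eq_gTilde_add hε.ne', fun p hp =>
    proposition3p1_general hγ₀.le hγ₁.le (inv_pos.2 hC) hdecay hα.unimodal
      hK_uc.continuous.aemeasurable (Eventually.of_forall hK_pos) (zero_lt_one.trans_le hp)⟩
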